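/- Let $\mathrm{SU}(1,1)$ be the group of complex $2\times 2$ matrices $g$ with $\det g=1$ and $\bar g^{\,t}\sigma_z g=\sigma_z$, where $\sigma_z=\mathrm{diag}(1,-1)$, and let $\mathrm{Spin}_{\mathbb R}(\tfrac12)$ be the group of real $2\times 2$ matrices of determinant $1$, both with the topology induced from the space of matrices. For real $\theta,t,\xi$ put, in $\mathrm{SU}(1,1)$, $$k_\theta=\begin{pmatrix}e^{i\theta/2}&0\\0&e^{-i\theta/2}\end{pmatrix},\quad d_t=\begin{pmatrix}\cosh\frac t2&\sinh\frac t2\\ \sinh\frac t2&\cosh\frac t2\end{pmatrix},\quad n_\xi=\begin{pmatrix}1+\frac{i\xi}2&-\frac{i\xi}2\\ \frac{i\xi}2&1-\frac{i\xi}2\end{pmatrix},$$ and, in $\mathrm{Spin}_{\mathbb R}(\tfrac12)$, $$k_\theta=\begin{pmatrix}\cos\frac\theta2&\sin\frac\theta2\\-\sin\frac\theta2&\cos\frac\theta2\end{pmatrix},\quad d_t=\begin{pmatrix}e^{t/2}&0\\0&e^{-t/2}\end{pmatrix},\quad n_\xi=\begin{pmatrix}1&\xi\\0&1\end{pmatrix}.$$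 With $C=\frac1{\sqrt2}\begin{pmatrix}1&-i\\1&i\end{pmatrix}$, the map $g\mapsto CgC^{-1}$ is an isomorphism of topological groups from $\mathrm{Spin}_{\mathbb R}(\tfrac12)$ onto $\mathrm{SU}(1,1)$ which takes $k_\theta,d_t,n_\xi$ to $k_\theta,d_t,n_\xi$. Let $G$ be either of the two groups. Every $g\in G$ is $g=k_\theta d_t n_\xi$ for exactly one $(\theta,t,\xi)\in[0,4\pi)\times\mathbb R\times\mathbb R$ (the Iwasawa decomposition), and the following hold. 1. For every real $\kappa>0$ (in particular for $\kappa=1$) there is exactly one left Haar measure $dg$ on $G$ such that for every continuous $f:G\to\mathbb C$ with compact support $$\int_G f(g)\,dg=\frac{\kappa}{4\pi}\int_0^{4\pi}\int_{-\infty}^{\infty}\int_{-\infty}^{\infty}f(k_\theta d_t n_\xi)\,e^t\,d\theta\,dt\,d\xi,$$ where the triple integral converges absolutely. 2. Let $h>0$ and $\hbar=\frac{h}{2\pi}$. If the left Haar measure of part 1 with $\kappa=1$ is multiplied by the scalar $\hbar$, the result is a left Haar measure on $G$, and for the same functions $f$ the integral with respect to it is $$\frac{\hbar}{4\pi}\int_0^{4\pi}\int_{-\infty}^{\infty}\int_{-\infty}^{\infty}f(k_\theta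 d_t n_\xi)\,e^t\,d\theta\,dt\,d\xi=\frac{h}{8\pi^2}\int_0^{4\pi}\int_{-\infty}^{\infty}\int_{-\infty}^{\infty}f(k_\theta d_t n_\xi)\,e^t\,d\theta\,dt\,d\xi.$$ -/

import Mathlib

open MeasureTheory
open scoped ComplexConjugate Matrix

noncomputable section

/-- The Pauli matrix `σ_z = diag(1, -1)`. -/
def sigmaZ : Matrix (Fin 2) (Fin 2) ℂ := !![1, 0; 0, -1]

/-- `SU(1,1)`: complex `2 × 2` matrices `g` of determinant one with `gᴴ σ_z g = σ_z`. Its topology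
is the subspace topology coming from the space of complex matrices. -/
def SU11 : Subgroup (Matrix.SpecialLinearGroup (Fin 2) ℂ) where
  carrier := {g | (g : Matrix (Fin 2) (Fin 2) ℂ)ᴴ * sigmaZ * (g : Matrix (Fin 2) (Fin 2) ℂ) = sigmaZ}
  one_mem' := by simp
  mul_mem' := by
    intro a b ha hb
    simp only [Set.mem_ofPred_eq] at ha hb ⊢
    calc ((a * b : Matrix.SpecialLinearGroup (Fin 2) ℂ) : Matrix (Fin 2) (Fin 2) ℂ)ᴴ * sigmaZ
          * ((a * b : Matrix.SpecialLinearGroup (Fin 2) ℂ) : Matrix (Fin 2) (Fin 2) ℂ)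
        = (b : Matrix (Fin 2) (Fin 2) ℂ)ᴴ * ((a : Matrix (Fin 2) (Fin 2) ℂ)ᴴ * sigmaZ
            * (a : Matrix (Fin 2) (Fin 2) ℂ)) * (b : Matrix (Fin 2) (Fin 2) ℂ) := by
          simp [Matrix.conjTranspose_mul, Matrix.mul_assoc]
      _ = sigmaZ := by rw [ha, hb]
  inv_mem' := by
    intro a ha
    simp only [Set.mem_ofPred_eq] at ha ⊢
    have h1 : (a : Matrix (Fin 2) (Fin 2) ℂ) *
        ((a⁻¹ : Matrix.SpecialLinearGroup (Fin 2) ℂ) : Matrix (Fin 2) (Fin 2) ℂ) = 1 := by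
      rw [← Matrix.SpecialLinearGroup.coe_mul, mul_inv_cancel, Matrix.SpecialLinearGroup.coe_one]
    have h2 : ((a⁻¹ : Matrix.SpecialLinearGroup (Fin 2) ℂ) : Matrix (Fin 2) (Fin 2) ℂ)ᴴ *
        (a : Matrix (Fin 2) (Fin 2) ℂ)ᴴ = 1 := by
      rw [← Matrix.conjTranspose_mul, h1, Matrix.conjTranspose_one]
    generalize ((a⁻¹ : Matrix.SpecialLinearGroup (Fin 2) ℂ) : Matrix (Fin 2) (Fin 2) ℂ) = b at h1 h2 ⊢
    calc bᴴ * sigmaZ * b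
        = bᴴ * ((a : Matrix (Fin 2) (Fin 2) ℂ)ᴴ * sigmaZ * (a : Matrix (Fin 2) (Fin 2) ℂ)) * b := by
          rw [ha]
      _ = (bᴴ * (a : Matrix (Fin 2) (Fin 2) ℂ)ᴴ) * sigmaZ
            * ((a : Matrix (Fin 2) (Fin 2) ℂ) * b) := by
          simp only [Matrix.mul_assoc]
      _ = sigmaZ := by rw [h1, h2, one_mul, mul_one]

/-- `Spin_ℝ(1/2)`: real `2 × 2` matrices of determinant one. -/
abbrev SpinHalf : Type := Matrix.SpecialLinearGroup (Fin 2) ℝ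

/-- The element of `SU(1,1)` with rows `(α, β)` and `(conj β, conj α)`, where `|α|² - |β|² = 1`. -/
def SU11.mk (α β : ℂ) (h : α * conj α - β * conj β = 1) : SU11 :=
  ⟨⟨!![α, β; conj β, conj α], by rw [Matrix.det_fin_two_of]; exact h⟩, by
    change (!![α, β; conj β, conj α])ᴴ * sigmaZ * !![α, β; conj β, conj α] = sigmaZ
    ext i j
    fin_cases i <;> fin_cases j <;>
      simp [sigmaZ, Matrix.mul_apply, Fin.sum_univ_two]
    · linear_combination h
    · ring
    · ring
    · linear_combination -h⟩

/-- `k_θ = diag(e^{iθ/2}, e^{-iθ/2})` in `SU(1,1)`. -/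
def SU11.k (θ : ℝ) : SU11 :=
  SU11.mk (Complex.exp (Complex.I * (θ / 2))) 0 (by
    rw [← Complex.exp_conj, ← Complex.exp_add]
    simp [Complex.conj_ofNat])

/-- `d_t` in `SU(1,1)`, with rows `(cosh (t/2), sinh (t/2))` and `(sinh (t/2), cosh (t/2))`. -/
def SU11.d (t : ℝ) : SU11 :=
  SU11.mk (Real.cosh (t / 2) : ℝ) (Real.sinh (t / 2) : ℝ) (by
    rw [Complex.conj_ofReal, Complex.conj_ofReal]
    norm_cast
    have := Real.cosh_sq (t / 2)
    linear_combination this)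

/-- `n_ξ` in `SU(1,1)`, with rows `(1 + iξ/2, -iξ/2)` and `(iξ/2, 1 - iξ/2)`. -/
def SU11.n (ξ : ℝ) : SU11 :=
  SU11.mk (1 + Complex.I * (ξ / 2)) (-(Complex.I * (ξ / 2))) (by
    simp [Complex.conj_ofNat]
    ring)

/-- `k_θ` in `Spin_ℝ(1/2)`, a rotation by the angle `-θ/2`. -/
def SpinHalf.k (θ : ℝ) : SpinHalf :=
  ⟨!![Real.cos (θ / 2), Real.sin (θ / 2); -Real.sin (θ / 2), Real.cos (θ / 2)], by
    rw [Matrix.det_fin_two_of]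
    have := Real.sin_sq_add_cos_sq (θ / 2)
    linear_combination this⟩

/-- `d_t = diag(e^{t/2}, e^{-t/2})` in `Spin_ℝ(1/2)`. -/
def SpinHalf.d (t : ℝ) : SpinHalf :=
  ⟨!![Real.exp (t / 2), 0; 0, Real.exp (-(t / 2))], by
    rw [Matrix.det_fin_two_of, ← Real.exp_add]
    simp⟩

/-- `n_ξ` in `Spin_ℝ(1/2)`, the upper unitriangular matrix with off-diagonal entry `ξ`. -/
def SpinHalf.n (ξ : ℝ) : SpinHalf :=
  ⟨!![1, ξ; 0, 1], by simp [Matrix.det_fin_two_of]⟩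

/-- The unitary Cayley matrix `C` that conjugates `Spin_ℝ(1/2)` onto `SU(1,1)`. -/
def cayleyC : Matrix (Fin 2) (Fin 2) ℂ :=
  ((Real.sqrt 2 : ℝ) : ℂ)⁻¹ • !![1, -Complex.I; 1, Complex.I]

/-- Every `g` is `k_θ d_t n_ξ` for exactly one triple `(θ, t, ξ)` with `0 ≤ θ < 4π`. -/
def IsIwasawaDecomposition {G : Type*} [Group G] (k d n : ℝ → G) : Prop :=
  ∀ g : G, ∃! p : ℝ × ℝ × ℝ,
    p.1 ∈ Set.Ico (0 : ℝ) (4 * Real.pi) ∧ k p.1 * d p.2.1 * n p.2.2 = g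

/-- The integral of `f (k_θ d_t n_ξ) e^t` over `0 ≤ θ ≤ 4π` and real `t`, `ξ`. -/
def iwasawaIntegral {G : Type*} [Group G] (k d n : ℝ → G) (f : G → ℂ) : ℂ :=
  ∫ θ in (0 : ℝ)..(4 * Real.pi), ∫ t : ℝ, ∫ ξ : ℝ, f (k θ * d t * n ξ) * (Real.exp t : ℝ)

/-- `μ` is integration in Iwasawa coordinates with normalising constant `c`: for every continuous
`f` with compact support the triple integral converges absolutely and, multiplied by `c`, equals
`∫ f dμ`. -/
def HasIwasawaFormula {G : Type*} [Group G] [TopologicalSpace G] [MeasurableSpace G]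
    (k d n : ℝ → G) (c : ℝ) (μ : Measure G) : Prop :=
  ∀ f : G → ℂ, Continuous f → HasCompactSupport f →
    Integrable (fun p : ℝ × ℝ × ℝ => f (k p.1 * d p.2.1 * n p.2.2) * (Real.exp p.2.1 : ℝ))
      ((volume.restrict (Set.Ioc (0 : ℝ) (4 * Real.pi))).prod (volume.prod volume)) ∧
    ∫ g, f g ∂μ = (c : ℂ) * iwasawaIntegral k d n f

/-- For `κ > 0` there is exactly one left Haar measure on `G` which is given in Iwasawa coordinates
by the constant `κ / 4π`. -/
def HaarIwasawa {G : Type*} [Group G] [TopologicalSpace G] [MeasurableSpace G]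
    (k d n : ℝ → G) : Prop :=
  ∀ κ : ℝ, 0 < κ →
    ∃! μ : Measure G, μ.IsHaarMeasure ∧ HasIwasawaFormula k d n (κ / (4 * Real.pi)) μ

/-- With `h > 0` and `ħ = h / 2π`, inserting the scalar factor `ħ` in the Haar measure of constant
`1 / 4π` gives a left Haar measure, whose constant is `ħ / 4π`, which is also `h / 8π²`. -/
def HaarIwasawaPlanck {G : Type*} [Group G] [TopologicalSpace G] [MeasurableSpace G]
    (k d n : ℝ → G) : Prop :=
  ∀ h hbar : ℝ, 0 < h → hbar = h / (2 * Real.pi) →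
    ∀ μ : Measure G, μ.IsHaarMeasure → HasIwasawaFormula k d n (1 / (4 * Real.pi)) μ →
      (ENNReal.ofReal hbar • μ).IsHaarMeasure ∧
      HasIwasawaFormula k d n (hbar / (4 * Real.pi)) (ENNReal.ofReal hbar • μ) ∧
      HasIwasawaFormula k d n (h / (8 * Real.pi ^ 2)) (ENNReal.ofReal hbar • μ)

end

/-!
The Cayley matrix conjugates the standard subgroups of `SL(2, ℝ)` to those of `SU(1,1)`, so it
suffices to treat `SL(2, ℝ)` and to transport along `cayleyEquiv`.

An element of `SL(2, ℝ)` is determined by its first column `u`, a nonzero vector of the plane, up to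
right multiplication by some `n_ξ` (`SpinHalf.eq_mul_n_of_col_eq`). The element `k_θ d_t` has
first column `e^{t/2} (cos (θ/2), -sin (θ/2))`, so that `(θ, t)` are polar coordinates of `u`, and
this is the Iwasawa decomposition. Moreover the plane measure is `du = (1/4) e^t dθ dt` on
`0 < θ ≤ 4π`, so that `e^t dθ dt dξ = 4 du dξ` (`SpinHalf.lintegral_iwasawaMeasure`).

In the coordinates `(u, ξ)` left invariance is immediate. Multiplication by `g` acts on the column
as `u ↦ g u`, which preserves `du` because `det g = 1` (`SpinHalf.lintegral_linear`), and it acts on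
each coset of `{n_ξ}` as a translation of `ξ` (`SpinHalf.fiberIntegral_mul_left`). The measure is
finite on compact sets because `t = log |u|²` and `ξ` are continuous functions on the group, so it is
a Haar measure. Uniqueness of a Haar measure with prescribed integrals of compactly supported
continuous functions is the uniqueness in the Riesz–Markov–Kakutani theorem, since Haar measures on
second countable locally compact groups are regular.
-/

open scoped ENNReal

/-! ### First columns and the Iwasawa decomposition of `SL(2, ℝ)` -/

namespace SpinHalf

lemma ext_entries {g h : SpinHalf} (h00 : g 0 0 = h 0 0) (h01 : g 0 1 = h 0 1)
    (h10 : g 1 0 = h 1 0) (h11 : g 1 1 = h 1 1) : g = h := by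
  ext i j
  fin_cases i <;> fin_cases j <;> assumption

lemma det_entries (g : SpinHalf) : g 0 0 * g 1 1 - g 0 1 * g 1 0 = 1 := by
  rw [← Matrix.det_fin_two]
  exact g.det_coe

lemma mul_entry (g h : SpinHalf) (i j : Fin 2) :
    (g * h) i j = g i 0 * h 0 j + g i 1 * h 1 j := by
  simp [Matrix.SpecialLinearGroup.coe_mul, Matrix.mul_apply, Fin.sum_univ_two]

lemma n_add (ξ η : ℝ) : n (ξ + η) = n ξ * n η := by
  apply ext_entries <;> simp only [mul_entry] <;> simp [n, add_comm]

/-- The group `{n_ξ}` acts transitively from the right on the elements with a given first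
column. -/
lemma eq_mul_n_of_col_eq {g h : SpinHalf} (h0 : g 0 0 = h 0 0) (h1 : g 1 0 = h 1 0) :
    ∃ ξ, g = h * n ξ := by
  have hg := det_entries g
  have hh := det_entries h
  refine ⟨h 1 1 * g 0 1 - h 0 1 * g 1 1, ?_⟩
  apply ext_entries <;> simp only [mul_entry] <;> simp [n, h0, h1]
  · rw [h0, h1] at hg
    linear_combination (-g 0 1) * hh + h 0 1 * hg
  · rw [h0, h1] at hg
    linear_combination (-g 1 1) * hh + h 1 1 * hg

lemma k_mul_d_col (θ t : ℝ) : (k θ * d t) 0 0 = Real.exp (t / 2) * Real.cos (θ / 2) ∧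
    (k θ * d t) 1 0 = -(Real.exp (t / 2) * Real.sin (θ / 2)) := by
  constructor <;> simp only [mul_entry] <;> simp [k, d, mul_comm]

lemma mul_n_col (g : SpinHalf) (ξ : ℝ) : (g * n ξ) 0 0 = g 0 0 ∧ (g * n ξ) 1 0 = g 1 0 := by
  constructor <;> simp only [mul_entry] <;> simp [n]

/-- The squared length of the first column. It is `e^t` on `k_θ d_t n_ξ`. -/
noncomputable def colNormSq (g : SpinHalf) : ℝ := g 0 0 ^ 2 + g 1 0 ^ 2

lemma colNormSq_pos (g : SpinHalf) : 0 < colNormSq g := by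
  have h := det_entries g
  rcases eq_or_ne (g 0 0) 0 with h0 | h0
  · have : g 1 0 ≠ 0 := by
      intro h1
      simp [h0, h1] at h
    unfold colNormSq
    positivity
  · unfold colNormSq
    positivity

lemma colNormSq_kdn (θ t ξ : ℝ) : colNormSq (k θ * d t * n ξ) = Real.exp t := by
  have h := Real.sin_sq_add_cos_sq (θ / 2)
  have ht : Real.exp t = Real.exp (t / 2) ^ 2 := by
    rw [← Real.exp_nat_mul]
    congr 1
    push_cast
    ring
  rw [colNormSq, (mul_n_col _ ξ).1, (mul_n_col _ ξ).2, (k_mul_d_col θ t).1, (k_mul_d_col θ t).2, ht]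
  linear_combination Real.exp (t / 2) ^ 2 * h

/-- The coordinate `ξ` of `k_θ d_t n_ξ`, as a function on the group: the inner product of the two
columns over the squared length of the first. -/
noncomputable def nCoord (g : SpinHalf) : ℝ := (g 0 0 * g 0 1 + g 1 0 * g 1 1) / colNormSq g

lemma nCoord_kdn (θ t ξ : ℝ) : nCoord (k θ * d t * n ξ) = ξ := by
  have hpos := colNormSq_pos (k θ * d t * n ξ)
  rw [nCoord, div_eq_iff hpos.ne', colNormSq]
  simp only [mul_entry]
  simp [k, d, n]
  ring

/-- `k_{-2φ} d_{2 log r}` for the polar coordinates `(r, φ)` of `u`: an element with first column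
`u`, when `u ≠ 0`. -/
noncomputable def colSection (u : ℝ × ℝ) : SpinHalf :=
  k (-2 * Complex.arg ⟨u.1, u.2⟩) * d (2 * Real.log ‖(⟨u.1, u.2⟩ : ℂ)‖)

lemma colSection_col {u : ℝ × ℝ} (hu : u ≠ 0) :
    colSection u 0 0 = u.1 ∧ colSection u 1 0 = u.2 := by
  have hz : (⟨u.1, u.2⟩ : ℂ) ≠ 0 := by
    intro h
    apply hu
    ext
    · exact congrArg Complex.re h
    · exact congrArg Complex.im h
  have h1 : -2 * Complex.arg ⟨u.1, u.2⟩ / 2 = -Complex.arg ⟨u.1, u.2⟩ := by ring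
  have h2 : 2 * Real.log ‖(⟨u.1, u.2⟩ : ℂ)‖ / 2 = Real.log ‖(⟨u.1, u.2⟩ : ℂ)‖ := by ring
  rw [colSection, (k_mul_d_col _ _).1, (k_mul_d_col _ _).2, h1, h2,
    Real.exp_log (norm_pos_iff.2 hz), Real.cos_neg, Real.sin_neg]
  refine ⟨Complex.norm_mul_cos_arg _, ?_⟩
  rw [mul_neg, neg_neg]
  exact Complex.norm_mul_sin_arg _

lemma col_ne_zero (g : SpinHalf) : (g 0 0, g 1 0) ≠ (0 : ℝ × ℝ) := by
  intro h
  have h1 : g 0 0 = 0 := congrArg Prod.fst h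
  have h2 : g 1 0 = 0 := congrArg Prod.snd h
  have := colNormSq_pos g
  simp [colNormSq, h1, h2] at this

/-- Every element is `k_θ d_t n_ξ`, for some real `θ`. -/
lemma exists_kdn (g : SpinHalf) : ∃ θ t ξ, g = k θ * d t * n ξ := by
  obtain ⟨h0, h1⟩ := colSection_col (col_ne_zero g)
  obtain ⟨ξ, hξ⟩ := eq_mul_n_of_col_eq h0.symm h1.symm
  exact ⟨_, _, ξ, hξ⟩

lemma k_eq_iff {θ θ' : ℝ} : k θ = k θ' ↔ ∃ m : ℤ, θ' = θ + m • (4 * Real.pi) := by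
  constructor
  · intro h
    have hc : Real.cos (θ' / 2) = Real.cos (θ / 2) := by
      simpa [k] using congrArg (fun x : SpinHalf => x 0 0) h.symm
    have hs : Real.sin (θ' / 2) = Real.sin (θ / 2) := by
      simpa [k] using congrArg (fun x : SpinHalf => x 0 1) h.symm
    obtain ⟨m, hm⟩ := Real.Angle.angle_eq_iff_two_pi_dvd_sub.1 (Real.Angle.cos_sin_inj hc hs)
    refine ⟨m, ?_⟩
    rw [zsmul_eq_mul]
    linear_combination 2 * hm
  · rintro ⟨m, rfl⟩
    have h : (θ + m * (4 * Real.pi)) / 2 = θ / 2 + m * (2 * Real.pi) := by ring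
    apply ext_entries <;>
      simp [k, h, Real.cos_add_int_mul_two_pi, Real.sin_add_int_mul_two_pi]

lemma isIwasawaDecomposition : IsIwasawaDecomposition k d n := by
  intro g
  obtain ⟨θ, t, ξ, rfl⟩ := exists_kdn g
  have h4 : (0 : ℝ) < 4 * Real.pi := by positivity
  refine ⟨(toIcoMod h4 0 θ, t, ξ), ⟨by simpa using toIcoMod_mem_Ico h4 0 θ, ?_⟩, ?_⟩
  · have : k (toIcoMod h4 0 θ) = k θ :=
      k_eq_iff.2 ⟨toIcoDiv h4 0 θ, (toIcoMod_add_toIcoDiv_zsmul h4 0 θ).symm⟩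
    simp only [this]
  · rintro ⟨θ', t', ξ'⟩ ⟨hθ', h⟩
    have ht : t' = t := by
      have := congrArg colNormSq h
      rwa [colNormSq_kdn, colNormSq_kdn, Real.exp_eq_exp] at this
    have hξ : ξ' = ξ := by
      have := congrArg nCoord h
      rwa [nCoord_kdn, nCoord_kdn] at this
    subst ht hξ
    obtain ⟨m, hm⟩ := k_eq_iff.1 (mul_right_cancel (mul_right_cancel h))
    simp only [hm, toIcoMod_add_zsmul]
    rw [(toIcoMod_eq_self h4).2 (by simpa using hθ')]

end SpinHalf

/-! ### The Cayley isomorphism -/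

lemma SU11.ext_entries {g h : SU11}
    (h00 : (g : Matrix.SpecialLinearGroup (Fin 2) ℂ) 0 0 =
      (h : Matrix.SpecialLinearGroup (Fin 2) ℂ) 0 0)
    (h01 : (g : Matrix.SpecialLinearGroup (Fin 2) ℂ) 0 1 =
      (h : Matrix.SpecialLinearGroup (Fin 2) ℂ) 0 1)
    (h10 : (g : Matrix.SpecialLinearGroup (Fin 2) ℂ) 1 0 =
      (h : Matrix.SpecialLinearGroup (Fin 2) ℂ) 1 0)
    (h11 : (g : Matrix.SpecialLinearGroup (Fin 2) ℂ) 1 1 =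
      (h : Matrix.SpecialLinearGroup (Fin 2) ℂ) 1 1) : g = h := by
  apply Subtype.ext
  ext i j
  fin_cases i <;> fin_cases j <;> assumption

/-- An element of `SU(1,1)` has rows `(α, β)` and `(conj β, conj α)`. -/
lemma SU11.lower_row (g : SU11) :
    (g : Matrix.SpecialLinearGroup (Fin 2) ℂ) 1 0 =
      conj ((g : Matrix.SpecialLinearGroup (Fin 2) ℂ) 0 1) ∧
    (g : Matrix.SpecialLinearGroup (Fin 2) ℂ) 1 1 =
      conj ((g : Matrix.SpecialLinearGroup (Fin 2) ℂ) 0 0) := by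
  obtain ⟨g, hg⟩ := g
  have hdet : g 0 0 * g 1 1 - g 0 1 * g 1 0 = 1 := by
    rw [← Matrix.det_fin_two]
    exact g.det_coe
  change (g : Matrix (Fin 2) (Fin 2) ℂ)ᴴ * sigmaZ * (g : Matrix (Fin 2) (Fin 2) ℂ) = sigmaZ at hg
  have e := fun i j => congrFun (congrFun hg i) j
  have e00 := e 0 0
  have e01 := e 0 1
  have e11 := e 1 1
  simp [sigmaZ, Matrix.mul_apply, Fin.sum_univ_two] at e00 e01 e11
  -- Multiply the relation `gᴴ σ g = σ` on the right by `g⁻¹`, the adjugate of `g`.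
  constructor
  · have e10 := congrArg conj e01
    simp at e10
    linear_combination g 1 0 * e11 - g 1 1 * e10 + conj (g 0 1) * hdet
  · linear_combination (-g 1 1) * e00 + g 1 0 * e01 + conj (g 0 0) * hdet

lemma cayleyC_mul_conjTranspose : cayleyC * (((Real.sqrt 2 : ℝ) : ℂ)⁻¹ •
    !![1, 1; Complex.I, -Complex.I]) = 1 := by
  have h : ((Real.sqrt 2 : ℝ) : ℂ)⁻¹ * ((Real.sqrt 2 : ℝ) : ℂ)⁻¹ = 1 / 2 := by
    rw [← mul_inv, ← Complex.ofReal_mul, Real.mul_self_sqrt (by norm_num)]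
    norm_num
  rw [cayleyC, Matrix.smul_mul, Matrix.mul_smul, smul_smul, h]
  ext i j
  fin_cases i <;> fin_cases j <;> simp <;> norm_num

lemma cayleyC_inv :
    cayleyC⁻¹ = ((Real.sqrt 2 : ℝ) : ℂ)⁻¹ • !![1, 1; Complex.I, -Complex.I] :=
  Matrix.inv_eq_right_inv cayleyC_mul_conjTranspose

lemma cayley_conj_apply (a b c d : ℝ) :
    cayleyC * (!![a, b; c, d] : Matrix (Fin 2) (Fin 2) ℝ).map (fun x : ℝ => (x : ℂ)) * cayleyC⁻¹ =
      !![((a + d : ℂ) + Complex.I * (b - c)) / 2, ((a - d : ℂ) - Complex.I * (b + c)) / 2;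
        ((a - d : ℂ) + Complex.I * (b + c)) / 2, ((a + d : ℂ) - Complex.I * (b - c)) / 2] := by
  have h : ((Real.sqrt 2 : ℝ) : ℂ)⁻¹ * ((Real.sqrt 2 : ℝ) : ℂ)⁻¹ = 1 / 2 := by
    rw [← mul_inv, ← Complex.ofReal_mul, Real.mul_self_sqrt (by norm_num)]
    norm_num
  rw [cayleyC_inv, cayleyC, Matrix.smul_mul, Matrix.smul_mul, Matrix.mul_smul, smul_smul, h]
  have hI := Complex.I_mul_I
  ext i j
  fin_cases i <;> fin_cases j <;>
    simp only [Matrix.smul_apply, Matrix.mul_apply, Fin.sum_univ_two] <;> simp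
  · linear_combination (-d / 2 : ℂ) * hI
  · linear_combination (d / 2 : ℂ) * hI
  · linear_combination (d / 2 : ℂ) * hI
  · linear_combination (-d / 2 : ℂ) * hI

/-- The image `C g C⁻¹` of `g`, written out in entries. -/
noncomputable def cayleyFun (g : SpinHalf) : SU11 :=
  SU11.mk (((g 0 0 + g 1 1 : ℂ) + Complex.I * (g 0 1 - g 1 0)) / 2)
    (((g 0 0 - g 1 1 : ℂ) - Complex.I * (g 0 1 + g 1 0)) / 2) (by
    have h : (g 0 0 * g 1 1 - g 0 1 * g 1 0 : ℂ) = 1 := mod_cast SpinHalf.det_entries g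
    have hI := Complex.I_mul_I
    simp [Complex.conj_ofNat]
    linear_combination h + (g 0 1 * g 1 0 : ℂ) * hI)

/-- The preimage `C⁻¹ g C` of `g`, written out in entries: with `(α, β)` the upper row of `g`, the
lower row is `(conj β, conj α)`, so these entries are real. -/
noncomputable def cayleyInvFun (g : SU11) : SpinHalf :=
  let α := (g : Matrix.SpecialLinearGroup (Fin 2) ℂ) 0 0
  let β := (g : Matrix.SpecialLinearGroup (Fin 2) ℂ) 0 1
  ⟨!![α.re + β.re, α.im - β.im; -α.im - β.im, α.re - β.re], by
    have hdet : (g : Matrix.SpecialLinearGroup (Fin 2) ℂ) 0 0 *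
          (g : Matrix.SpecialLinearGroup (Fin 2) ℂ) 1 1 -
        (g : Matrix.SpecialLinearGroup (Fin 2) ℂ) 0 1 *
          (g : Matrix.SpecialLinearGroup (Fin 2) ℂ) 1 0 = 1 := by
      rw [← Matrix.det_fin_two]
      exact Matrix.SpecialLinearGroup.det_coe _
    rw [(SU11.lower_row g).1, (SU11.lower_row g).2] at hdet
    have := congrArg Complex.re hdet
    simp at this
    rw [Matrix.det_fin_two_of]
    linear_combination this⟩

lemma coe_cayleyFun (g : SpinHalf) :
    ((cayleyFun g : Matrix.SpecialLinearGroup (Fin 2) ℂ) : Matrix (Fin 2) (Fin 2) ℂ) =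
      cayleyC * (g : Matrix (Fin 2) (Fin 2) ℝ).map (fun x : ℝ => (x : ℂ)) * cayleyC⁻¹ := by
  rw [Matrix.eta_fin_two (g : Matrix (Fin 2) (Fin 2) ℝ), cayley_conj_apply]
  ext i j
  fin_cases i <;> fin_cases j <;> simp [cayleyFun, SU11.mk, Complex.conj_ofNat, sub_eq_add_neg]

lemma cayleyFun_mul (g h : SpinHalf) : cayleyFun (g * h) = cayleyFun g * cayleyFun h := by
  apply Subtype.ext
  apply Subtype.ext
  have hC : cayleyC⁻¹ * cayleyC = 1 := by
    rw [cayleyC_inv]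
    exact mul_eq_one_comm.1 cayleyC_mul_conjTranspose
  have hm : ((g * h : SpinHalf) : Matrix (Fin 2) (Fin 2) ℝ).map (fun x : ℝ => (x : ℂ)) =
      (g : Matrix (Fin 2) (Fin 2) ℝ).map (fun x : ℝ => (x : ℂ)) *
        (h : Matrix (Fin 2) (Fin 2) ℝ).map (fun x : ℝ => (x : ℂ)) := by
    rw [Matrix.SpecialLinearGroup.coe_mul]
    exact Matrix.map_mul (f := Complex.ofRealHom)
  change ((cayleyFun (g * h) : Matrix.SpecialLinearGroup (Fin 2) ℂ) : Matrix (Fin 2) (Fin 2) ℂ) =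
    ((cayleyFun g * cayleyFun h : Matrix.SpecialLinearGroup (Fin 2) ℂ) : Matrix (Fin 2) (Fin 2) ℂ)
  rw [Matrix.SpecialLinearGroup.coe_mul, coe_cayleyFun, coe_cayleyFun, coe_cayleyFun, hm]
  generalize (g : Matrix (Fin 2) (Fin 2) ℝ).map (fun x : ℝ => (x : ℂ)) = A
  generalize (h : Matrix (Fin 2) (Fin 2) ℝ).map (fun x : ℝ => (x : ℂ)) = B
  calc cayleyC * (A * B) * cayleyC⁻¹ = cayleyC * A * 1 * B * cayleyC⁻¹ := by
        simp only [Matrix.mul_assoc, Matrix.one_mul]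
    _ = _ := by rw [← hC]; simp only [Matrix.mul_assoc]

/-- Conjugation `g ↦ C g C⁻¹` by the Cayley matrix, as an isomorphism of topological groups. -/
noncomputable def cayleyEquiv : SpinHalf ≃ₜ* SU11 where
  toFun := cayleyFun
  invFun := cayleyInvFun
  left_inv g := by
    apply SpinHalf.ext_entries <;> simp [cayleyFun, cayleyInvFun, SU11.mk] <;> ring
  right_inv g := by
    have h := SU11.lower_row g
    apply SU11.ext_entries
    · simp [cayleyFun, cayleyInvFun, SU11.mk]
      apply Complex.ext <;> simp
    · simp [cayleyFun, cayleyInvFun, SU11.mk]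
      apply Complex.ext <;> simp
    · rw [h.1]
      simp [cayleyFun, cayleyInvFun, SU11.mk, Complex.conj_ofNat]
      apply Complex.ext <;> simp
      ring
    · rw [h.2]
      simp [cayleyFun, cayleyInvFun, SU11.mk, Complex.conj_ofNat]
      apply Complex.ext <;> simp
  map_mul' := cayleyFun_mul
  continuous_toFun := by
    refine continuous_induced_rng.2 (continuous_induced_rng.2 ?_)
    refine continuous_matrix fun i j => ?_
    fin_cases i <;> fin_cases j <;>
      simp [cayleyFun, SU11.mk, Function.comp_def] <;> fun_prop
  continuous_invFun := by
    refine continuous_induced_rng.2 ?_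
    have hc : ∀ i j, Continuous fun g : SU11 => (g : Matrix.SpecialLinearGroup (Fin 2) ℂ) i j :=
      fun i j => by fun_prop
    have h0 := hc 0 0
    have h1 := hc 0 1
    change Continuous fun g : SU11 =>
      let α := (g : Matrix.SpecialLinearGroup (Fin 2) ℂ) 0 0
      let β := (g : Matrix.SpecialLinearGroup (Fin 2) ℂ) 0 1
      !![α.re + β.re, α.im - β.im; -α.im - β.im, α.re - β.re]
    refine continuous_matrix fun i j => ?_
    fin_cases i <;> fin_cases j <;> simp <;> fun_prop

lemma cayleyEquiv_k (θ : ℝ) : cayleyEquiv (SpinHalf.k θ) = SU11.k θ := by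
  have h : (Complex.cos (θ / 2) + Complex.cos (θ / 2) +
      Complex.I * (Complex.sin (θ / 2) + Complex.sin (θ / 2))) / 2 =
        Complex.exp (Complex.I * (θ / 2)) := by
    rw [mul_comm Complex.I (θ / 2 : ℂ), Complex.exp_mul_I]
    ring
  change cayleyFun _ = _
  apply SU11.ext_entries <;> simp [cayleyFun, SpinHalf.k, SU11.k, SU11.mk, h]

lemma cayleyEquiv_d (t : ℝ) : cayleyEquiv (SpinHalf.d t) = SU11.d t := by
  change cayleyFun _ = _
  apply SU11.ext_entries <;>
    simp [cayleyFun, SpinHalf.d, SU11.d, SU11.mk, Complex.cosh, Complex.sinh, Complex.conj_ofNat]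

lemma cayleyEquiv_n (ξ : ℝ) : cayleyEquiv (SpinHalf.n ξ) = SU11.n ξ := by
  change cayleyFun _ = _
  apply SU11.ext_entries <;>
    simp [cayleyFun, SpinHalf.n, SU11.n, SU11.mk, Complex.conj_ofNat] <;> ring

/-! ### Topology and coordinates of `SL(2, ℝ)` -/

namespace SpinHalf

instance : LocallyCompactSpace SpinHalf :=
  haveI : LocallyCompactSpace (Matrix (Fin 2) (Fin 2) ℝ) :=
    inferInstanceAs (LocallyCompactSpace (Fin 2 → Fin 2 → ℝ))
  Matrix.SpecialLinearGroup.isClosedEmbedding_val.locallyCompactSpace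

instance : SecondCountableTopology SpinHalf :=
  haveI : SecondCountableTopology (Matrix (Fin 2) (Fin 2) ℝ) :=
    inferInstanceAs (SecondCountableTopology (Fin 2 → Fin 2 → ℝ))
  Matrix.SpecialLinearGroup.isClosedEmbedding_val.isEmbedding.secondCountableTopology

instance : T2Space SpinHalf :=
  Matrix.SpecialLinearGroup.isClosedEmbedding_val.isEmbedding.t2Space

lemma continuous_k : Continuous k := by
  refine continuous_induced_rng.2 ?_
  change Continuous fun θ : ℝ =>
    !![Real.cos (θ / 2), Real.sin (θ / 2); -Real.sin (θ / 2), Real.cos (θ / 2)]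
  refine continuous_matrix fun i j => ?_
  fin_cases i <;> fin_cases j <;> simp <;> fun_prop

lemma continuous_d : Continuous d := by
  refine continuous_induced_rng.2 ?_
  change Continuous fun t : ℝ => !![Real.exp (t / 2), 0; 0, Real.exp (-(t / 2))]
  refine continuous_matrix fun i j => ?_
  fin_cases i <;> fin_cases j <;> simp <;> fun_prop

lemma continuous_n : Continuous n := by
  refine continuous_induced_rng.2 ?_
  change Continuous fun ξ : ℝ => !![1, ξ; 0, 1]
  refine continuous_matrix fun i j => ?_
  fin_cases i <;> fin_cases j <;> simp <;> fun_prop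

lemma continuous_entry (i j : Fin 2) : Continuous fun g : SpinHalf => g i j := by
  fun_prop

lemma continuous_colNormSq : Continuous colNormSq := by
  unfold colNormSq
  have := continuous_entry
  fun_prop

lemma continuous_nCoord : Continuous nCoord := by
  have := continuous_entry
  exact Continuous.div (by fun_prop) continuous_colNormSq fun g => (colNormSq_pos g).ne'

lemma continuous_kdn : Continuous fun p : ℝ × ℝ × ℝ => k p.1 * d p.2.1 * n p.2.2 := by
  have := continuous_k
  have := continuous_d
  have := continuous_n
  fun_prop

/-- The measure `e^t dθ dt dξ` on `(0, 4π] × ℝ × ℝ`. -/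
noncomputable def coordMeasure : Measure (ℝ × ℝ × ℝ) :=
  ((volume.restrict (Set.Ioc (0 : ℝ) (4 * Real.pi))).prod (volume.prod volume)).withDensity
    fun p => (Real.toNNReal (Real.exp p.2.1) : ℝ≥0∞)

instance : IsLocallyFiniteMeasure coordMeasure := by
  unfold coordMeasure
  exact IsLocallyFiniteMeasure.withDensity_coe (by fun_prop)

/-! ### Fibring over the first column -/

/-- The integral of `F` along the coset `colSection u * {n_ξ}`. For `u ≠ 0` this is the set of the
elements with first column `u`. -/
noncomputable def fiberIntegral (F : SpinHalf → ℝ≥0∞) (u : ℝ × ℝ) : ℝ≥0∞ :=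
  ∫⁻ ξ, F (colSection u * n ξ)

/-- By translation invariance in `ξ`, the integral along a coset does not depend on the element of
the coset from which `ξ` is counted. -/
lemma fiberIntegral_col (F : SpinHalf → ℝ≥0∞) (h : SpinHalf) :
    fiberIntegral F (h 0 0, h 1 0) = ∫⁻ ξ, F (h * n ξ) := by
  obtain ⟨h0, h1⟩ := colSection_col (col_ne_zero h)
  obtain ⟨c, hc⟩ := eq_mul_n_of_col_eq h0.symm h1.symm
  rw [fiberIntegral, ← lintegral_add_left_eq_self _ c]
  simp only [n_add, ← mul_assoc, ← hc]

/-- The first column of `k_θ d_t`. -/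
noncomputable def colOf (θ t : ℝ) : ℝ × ℝ :=
  (Real.exp (t / 2) * Real.cos (θ / 2), -(Real.exp (t / 2) * Real.sin (θ / 2)))

lemma lintegral_kdn (F : SpinHalf → ℝ≥0∞) (θ t : ℝ) :
    ∫⁻ ξ, F (k θ * d t * n ξ) = fiberIntegral F (colOf θ t) := by
  rw [← fiberIntegral_col, (k_mul_d_col θ t).1, (k_mul_d_col θ t).2, colOf]

/-! ### Polar coordinates and linear maps of the plane -/

/-- Half-angle coordinates cover the circle: `θ ↦ -θ/2` maps `(0, 4π]` onto one period. -/
lemma lintegral_neg_half {H : ℝ → ℝ≥0∞} (hH : Function.Periodic H (2 * Real.pi)) :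
    ∫⁻ θ in Set.Ioc (0 : ℝ) (4 * Real.pi), H (-θ / 2) =
      2 * ∫⁻ φ in Set.Ioo (-Real.pi) Real.pi, H φ := by
  have hder : ∀ θ ∈ Set.Ioc (0 : ℝ) (4 * Real.pi),
      HasDerivWithinAt (fun θ : ℝ => -θ / 2) (-1 / 2) (Set.Ioc (0 : ℝ) (4 * Real.pi)) θ :=
    fun θ _ => ((hasDerivAt_id θ).neg.div_const 2).hasDerivWithinAt
  have hinj : Set.InjOn (fun θ : ℝ => -θ / 2) (Set.Ioc (0 : ℝ) (4 * Real.pi)) := by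
    intro x _ y _ h
    simp only at h
    linarith
  have himg : (fun θ : ℝ => -θ / 2) '' Set.Ioc (0 : ℝ) (4 * Real.pi) =
      Set.Ico (-(2 * Real.pi)) 0 := by
    ext x
    constructor
    · rintro ⟨y, ⟨h1, h2⟩, rfl⟩
      constructor <;> simp only <;> linarith
    · rintro ⟨h1, h2⟩
      refine ⟨-2 * x, ⟨by linarith, by linarith⟩, by ring⟩
  have h := lintegral_image_eq_lintegral_abs_deriv_mul measurableSet_Ioc hder hinj H
  have habs : |(-1 / 2 : ℝ)| = 1 / 2 := by
    rw [abs_of_nonpos (by norm_num)]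
    norm_num
  rw [himg, habs, lintegral_const_mul' _ _ ENNReal.ofReal_ne_top,
    show ENNReal.ofReal (1 / 2) = 2⁻¹ by
      rw [one_div, ENNReal.ofReal_inv_of_pos two_pos, ENNReal.ofReal_ofNat]] at h
  have h2 : ∫⁻ φ in Set.Ico (-(2 * Real.pi)) 0, H φ = ∫⁻ φ in Set.Ioo (-Real.pi) Real.pi, H φ := by
    rw [restrict_Ico_eq_restrict_Ioc, restrict_Ioo_eq_restrict_Ioc]
    have e1 := isAddFundamentalDomain_Ioc Real.two_pi_pos (-(2 * Real.pi))
    have e2 := isAddFundamentalDomain_Ioc Real.two_pi_pos (-Real.pi)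
    rw [show -(2 * Real.pi) + 2 * Real.pi = 0 by ring] at e1
    rw [show -Real.pi + 2 * Real.pi = Real.pi by ring] at e2
    refine e1.setLIntegral_eq e2 H ?_
    rintro ⟨_, m, rfl⟩ x
    rw [AddSubgroup.vadd_def, vadd_eq_add, add_comm]
    exact hH.zsmul m x
  rw [← h2, h, ← mul_assoc, ENNReal.mul_inv_cancel two_ne_zero ENNReal.ofNat_ne_top, one_mul]

/-- The substitution `r = e^{t/2}` in the radial integral of the plane. -/
lemma lintegral_Ioi_exp_half (J : ℝ → ℝ≥0∞) :
    2 * ∫⁻ r in Set.Ioi (0 : ℝ), ENNReal.ofReal r * J r =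
      ∫⁻ t, J (Real.exp (t / 2)) * ENNReal.ofReal (Real.exp t) := by
  have hder : ∀ t ∈ (Set.univ : Set ℝ),
      HasDerivWithinAt (fun t : ℝ => Real.exp (t / 2)) (Real.exp (t / 2) * (1 / 2)) Set.univ t :=
    fun t _ => (((hasDerivAt_id t).div_const 2).exp).hasDerivWithinAt
  have hinj : Set.InjOn (fun t : ℝ => Real.exp (t / 2)) Set.univ := by
    intro x _ y _ h
    have := Real.exp_injective h
    linarith
  have himg : (fun t : ℝ => Real.exp (t / 2)) '' Set.univ = Set.Ioi 0 := by
    ext x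
    constructor
    · rintro ⟨y, -, rfl⟩
      exact Real.exp_pos _
    · intro hx
      refine ⟨2 * Real.log x, trivial, ?_⟩
      simp only [mul_div_cancel_left₀ _ (two_ne_zero' ℝ)]
      exact Real.exp_log hx
  have h := lintegral_image_eq_lintegral_abs_deriv_mul MeasurableSet.univ hder hinj
    fun r => ENNReal.ofReal r * J r
  rw [himg, Measure.restrict_univ] at h
  rw [h, ← lintegral_const_mul' _ _ ENNReal.ofNat_ne_top]
  refine lintegral_congr fun t => ?_
  have ht : Real.exp t = 2 * (|Real.exp (t / 2) * (1 / 2)| * Real.exp (t / 2)) := by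
    rw [abs_of_pos (by positivity), show Real.exp t = Real.exp (t / 2 + t / 2) by ring_nf,
      Real.exp_add]
    ring
  rw [ht, ENNReal.ofReal_mul two_pos.le, ENNReal.ofReal_mul (abs_nonneg _), ENNReal.ofReal_ofNat]
  ring

/-- Integration over the plane in the coordinates `(θ, t)` of the column `k_θ d_t e₁`. -/
lemma lintegral_colOf {J : ℝ × ℝ → ℝ≥0∞} (hJ : Measurable J) :
    ∫⁻ θ in Set.Ioc (0 : ℝ) (4 * Real.pi), ∫⁻ t, J (colOf θ t) * ENNReal.ofReal (Real.exp t) =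
      4 * ∫⁻ u, J u := by
  have hper : Function.Periodic (fun φ : ℝ => ∫⁻ t, J (Real.exp (t / 2) * Real.cos φ,
      Real.exp (t / 2) * Real.sin φ) * ENNReal.ofReal (Real.exp t)) (2 * Real.pi) := by
    intro φ
    simp only [Real.cos_add_two_pi, Real.sin_add_two_pi]
  have h1 := lintegral_neg_half hper
  have hcol : ∀ θ t, colOf θ t =
      (Real.exp (t / 2) * Real.cos (-θ / 2), Real.exp (t / 2) * Real.sin (-θ / 2)) := by
    intro θ t
    rw [neg_div, Real.cos_neg, Real.sin_neg, mul_neg, colOf]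
  simp_rw [hcol]
  rw [h1, ← lintegral_comp_polarCoord_symm, polarCoord_target, Measure.volume_eq_prod,
    ← Measure.prod_restrict, lintegral_prod_symm]
  · have h2 : ∀ φ, ∫⁻ t, J (Real.exp (t / 2) * Real.cos φ, Real.exp (t / 2) * Real.sin φ) *
        ENNReal.ofReal (Real.exp t) = 2 * ∫⁻ r in Set.Ioi (0 : ℝ), ENNReal.ofReal r *
          J (r * Real.cos φ, r * Real.sin φ) :=
      fun φ => (lintegral_Ioi_exp_half fun r => J (r * Real.cos φ, r * Real.sin φ)).symm
    simp_rw [h2]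
    rw [lintegral_const_mul' _ _ ENNReal.ofNat_ne_top, ← mul_assoc]
    norm_num
  · refine Measurable.aemeasurable ?_
    simp only [polarCoord_symm_apply, smul_eq_mul]
    exact (by fun_prop : Measurable fun p : ℝ × ℝ => ENNReal.ofReal p.1).mul
      (hJ.comp (by fun_prop))

/-- Left multiplication by `g` maps the coset with first column `u` onto that with column `g u`. -/
lemma fiberIntegral_mul_left (F : SpinHalf → ℝ≥0∞) (g : SpinHalf) {u : ℝ × ℝ} (hu : u ≠ 0) :
    fiberIntegral (fun x => F (g * x)) u =
      fiberIntegral F (g 0 0 * u.1 + g 0 1 * u.2, g 1 0 * u.1 + g 1 1 * u.2) := by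
  obtain ⟨h0, h1⟩ := colSection_col hu
  have h := fiberIntegral_col F (g * colSection u)
  rw [mul_entry, mul_entry, h0, h1] at h
  rw [h, fiberIntegral]
  simp only [mul_assoc]

/-- A matrix of determinant one preserves the Lebesgue measure of the plane. -/
lemma lintegral_linear (g : SpinHalf) {J : ℝ × ℝ → ℝ≥0∞} (hJ : Measurable J) :
    ∫⁻ u : ℝ × ℝ, J (g 0 0 * u.1 + g 0 1 * u.2, g 1 0 * u.1 + g 1 1 * u.2) = ∫⁻ u, J u := by
  let b := Module.Basis.finTwoProd ℝ
  let L : ℝ × ℝ →ₗ[ℝ] ℝ × ℝ := Matrix.toLin b b (g : Matrix (Fin 2) (Fin 2) ℝ)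
  have hdet : LinearMap.det L = 1 := by
    rw [LinearMap.det_toLin]
    exact g.det_coe
  have hL : ∀ u : ℝ × ℝ, L u = (g 0 0 * u.1 + g 0 1 * u.2, g 1 0 * u.1 + g 1 1 * u.2) := by
    intro u
    simp only [L, b]
    conv_lhs => rw [Matrix.eta_fin_two (g : Matrix (Fin 2) (Fin 2) ℝ)]
    exact Matrix.toLin_finTwoProd_apply _ _ _ _ _
  have hmap := Measure.map_linearMap_addHaar_eq_smul_addHaar
    (μ := (volume : Measure (ℝ × ℝ))) (f := L) (by rw [hdet]; exact one_ne_zero)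
  rw [hdet] at hmap
  simp at hmap
  simp_rw [← hL]
  rw [← lintegral_map hJ L.continuous_of_finiteDimensional.measurable, hmap]

/-! ### The Haar measure in Iwasawa coordinates -/

variable [MeasurableSpace SpinHalf] [BorelSpace SpinHalf]

/-- The measure `e^t dθ dt dξ` in Iwasawa coordinates. -/
noncomputable def iwasawaMeasure : Measure SpinHalf :=
  coordMeasure.map fun p => k p.1 * d p.2.1 * n p.2.2

lemma measurable_colSection_mul_n :
    Measurable fun p : (ℝ × ℝ) × ℝ => colSection p.1 * n p.2 := by
  have hc : Measurable fun p : (ℝ × ℝ) × ℝ => Complex.measurableEquivRealProd.symm p.1 :=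
    Complex.measurableEquivRealProd.symm.measurable.comp measurable_fst
  have h4 : (fun p : (ℝ × ℝ) × ℝ => colSection p.1 * n p.2) =
      (fun p : ℝ × ℝ × ℝ => k p.1 * d p.2.1 * n p.2.2) ∘ fun p : (ℝ × ℝ) × ℝ =>
        (-2 * Complex.arg (Complex.measurableEquivRealProd.symm p.1),
          2 * Real.log ‖Complex.measurableEquivRealProd.symm p.1‖, p.2) := by
    ext1 p
    rfl
  rw [h4]
  refine continuous_kdn.measurable.comp ?_
  refine Measurable.prodMk ?_ (Measurable.prodMk ?_ ?_)
  · exact (Complex.measurable_arg.comp hc).const_mul (-2)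
  · exact (Real.measurable_log.comp hc.norm).const_mul 2
  · exact measurable_snd

lemma measurable_fiberIntegral {F : SpinHalf → ℝ≥0∞} (hF : Measurable F) :
    Measurable (fiberIntegral F) := by
  have h : Measurable fun p : (ℝ × ℝ) × ℝ => F (colSection p.1 * n p.2) :=
    hF.comp measurable_colSection_mul_n
  exact h.lintegral_prod_right'

/-- Integration in Iwasawa coordinates is, up to the factor `4`, Lebesgue integration over the first
column in the plane and over the coset of the elements with that column. -/
lemma lintegral_iwasawaMeasure {F : SpinHalf → ℝ≥0∞} (hF : Measurable F) :
    ∫⁻ g, F g ∂iwasawaMeasure = 4 * ∫⁻ u, fiberIntegral F u := by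
  have hm : Measurable fun p : ℝ × ℝ × ℝ => F (k p.1 * d p.2.1 * n p.2.2) :=
    hF.comp continuous_kdn.measurable
  have he : Measurable fun p : ℝ × ℝ × ℝ => (Real.toNNReal (Real.exp p.2.1) : ℝ≥0∞) := by fun_prop
  rw [iwasawaMeasure, lintegral_map hF continuous_kdn.measurable, coordMeasure,
    lintegral_withDensity_eq_lintegral_mul _ he hm, lintegral_prod _ (he.mul hm).aemeasurable,
    ← lintegral_colOf (measurable_fiberIntegral hF)]
  refine lintegral_congr fun θ => ?_
  rw [lintegral_prod _ (by exact ((he.mul hm).comp measurable_prodMk_left).aemeasurable)]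
  refine lintegral_congr fun t => ?_
  simp only [Pi.mul_apply]
  rw [lintegral_const_mul' _ _ ENNReal.coe_ne_top, mul_comm, lintegral_kdn]
  rfl

instance : (iwasawaMeasure : Measure SpinHalf).IsMulLeftInvariant := by
  refine ⟨fun g => Measure.ext_of_lintegral _ fun F hF => ?_⟩
  have hg : Measurable fun x : SpinHalf => g * x := (continuous_const_mul g).measurable
  have h := lintegral_iwasawaMeasure (hF.comp hg)
  simp only [Function.comp_apply] at h
  rw [lintegral_map hF hg, h, lintegral_iwasawaMeasure hF,
    ← lintegral_linear g (measurable_fiberIntegral hF)]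
  congr 1
  refine lintegral_congr_ae ?_
  have h0 : ∀ᵐ u : ℝ × ℝ, u ≠ 0 := by
    simp [ae_iff]
  filter_upwards [h0] with u hu
  exact fiberIntegral_mul_left F g hu

instance : IsFiniteMeasureOnCompacts (iwasawaMeasure : Measure SpinHalf) := by
  refine ⟨fun K hK => ?_⟩
  have hlog : Continuous fun g : SpinHalf => Real.log (colNormSq g) :=
    continuous_colNormSq.log fun g => (colNormSq_pos g).ne'
  -- The coordinates `t` and `ξ` are continuous on the group, hence bounded on `K`.
  have hC : IsCompact (Set.Icc (0 : ℝ) (4 * Real.pi) ×ˢ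
      (((fun g : SpinHalf => Real.log (colNormSq g)) '' K) ×ˢ (nCoord '' K))) :=
    isCompact_Icc.prod ((hK.image hlog).prod (hK.image continuous_nCoord))
  rw [iwasawaMeasure, Measure.map_apply continuous_kdn.measurable hK.measurableSet]
  have hsupp : ∀ᵐ p ∂coordMeasure, p.1 ∈ Set.Icc (0 : ℝ) (4 * Real.pi) := by
    refine (withDensity_absolutelyContinuous _ _).ae_le ?_
    refine Measure.quasiMeasurePreserving_fst.ae ?_
    filter_upwards [ae_restrict_mem measurableSet_Ioc] with θ hθ using Set.Ioc_subset_Icc_self hθ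
  refine lt_of_le_of_lt (measure_mono_ae ?_) hC.measure_lt_top
  filter_upwards [hsupp] with p hp hpK
  refine ⟨hp, ⟨_, hpK, ?_⟩, ⟨_, hpK, nCoord_kdn _ _ _⟩⟩
  simp only [colNormSq_kdn, Real.log_exp]

lemma iwasawaMeasure_ne_zero : (iwasawaMeasure : Measure SpinHalf) ≠ 0 := by
  intro h
  have h1 := lintegral_iwasawaMeasure (F := fun _ => 1) measurable_const
  rw [h] at h1
  simp [fiberIntegral] at h1

instance : (iwasawaMeasure : Measure SpinHalf).IsHaarMeasure :=
  haveI : NeZero (iwasawaMeasure : Measure SpinHalf) := ⟨iwasawaMeasure_ne_zero⟩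
  { toIsOpenPosMeasure := isOpenPosMeasure_of_mulLeftInvariant_of_regular }

lemma hasIwasawaFormula_iwasawaMeasure : HasIwasawaFormula k d n 1 iwasawaMeasure := by
  intro f hf hfc
  have hint : Integrable f iwasawaMeasure := hf.integrable_of_hasCompactSupport hfc
  have he : Measurable fun p : ℝ × ℝ × ℝ => Real.toNNReal (Real.exp p.2.1) := by fun_prop
  have hint' : Integrable
      (fun p : ℝ × ℝ × ℝ => f (k p.1 * d p.2.1 * n p.2.2) * (Real.exp p.2.1 : ℝ))
      ((volume.restrict (Set.Ioc (0 : ℝ) (4 * Real.pi))).prod (volume.prod volume)) := by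
    rw [iwasawaMeasure, integrable_map_measure hf.aestronglyMeasurable
      continuous_kdn.measurable.aemeasurable, coordMeasure,
      integrable_withDensity_iff_integrable_smul he] at hint
    refine hint.congr (.of_forall fun p => ?_)
    simp [NNReal.smul_def, mul_comm, max_eq_left (Real.exp_pos _).le]
  refine ⟨hint', ?_⟩
  rw [iwasawaMeasure, integral_map continuous_kdn.measurable.aemeasurable hf.aestronglyMeasurable,
    coordMeasure, integral_withDensity_eq_integral_smul he, iwasawaIntegral,
    intervalIntegral.integral_of_le (by positivity)]
  have hsm : ∀ p : ℝ × ℝ × ℝ, Real.toNNReal (Real.exp p.2.1) • f (k p.1 * d p.2.1 * n p.2.2) =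
      f (k p.1 * d p.2.1 * n p.2.2) * (Real.exp p.2.1 : ℝ) := by
    intro p
    simp [NNReal.smul_def, mul_comm, max_eq_left (Real.exp_pos _).le]
  simp only [hsm]
  rw [integral_prod _ hint', Complex.ofReal_one, one_mul]
  refine integral_congr_ae ?_
  filter_upwards [hint'.prod_right_ae] with θ hθ
  exact integral_prod _ hθ

end SpinHalf

/-! ### Transport and rescaling -/

section Group

variable {G H : Type*} [Group G] [Group H] {k d n : ℝ → G} {k' d' n' : ℝ → H}

lemma IsIwasawaDecomposition.map (e : G ≃* H) (hk : ∀ x, e (k x) = k' x)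
    (hd : ∀ x, e (d x) = d' x) (hn : ∀ x, e (n x) = n' x) (h : IsIwasawaDecomposition k d n) :
    IsIwasawaDecomposition k' d' n' := by
  intro g
  convert h (e.symm g) using 3 with p
  rw [← hk, ← hd, ← hn, ← map_mul, ← map_mul, e.eq_symm_apply]

variable [TopologicalSpace G] [TopologicalSpace H] [MeasurableSpace G] [MeasurableSpace H]

lemma HasIwasawaFormula.map [BorelSpace G] [BorelSpace H] {c : ℝ} {μ : Measure G} (e : G ≃ₜ* H)
    (hk : ∀ x, e (k x) = k' x) (hd : ∀ x, e (d x) = d' x) (hn : ∀ x, e (n x) = n' x)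
    (h : HasIwasawaFormula k d n c μ) : HasIwasawaFormula k' d' n' c (μ.map e) := by
  intro f hf hfc
  have h' := h (f ∘ e) (hf.comp e.continuous)
    (hfc.comp_homeomorph e.toHomeomorph)
  have hmap : ∫ y, f y ∂μ.map e = ∫ x, f (e x) ∂μ :=
    e.toHomeomorph.measurableEmbedding.integral_map f
  rw [hmap]
  simpa only [iwasawaIntegral, Function.comp_apply, map_mul, hk, hd, hn] using! h'

/-- Multiplying the measure by `r` multiplies the normalising constant by `r`. -/
lemma HasIwasawaFormula.smul {c r : ℝ} (hr : 0 ≤ r) {μ : Measure G}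
    (h : HasIwasawaFormula k d n c μ) :
    HasIwasawaFormula k d n (r * c) (ENNReal.ofReal r • μ) := by
  intro f hf hfc
  obtain ⟨h1, h2⟩ := h f hf hfc
  refine ⟨h1, ?_⟩
  rw [integral_smul_measure, h2, ENNReal.toReal_ofReal hr, Complex.real_smul, Complex.ofReal_mul,
    mul_assoc]

lemma isHaarMeasure_ofReal_smul {r : ℝ} (hr : 0 < r) (μ : Measure G) [μ.IsHaarMeasure] :
    (ENNReal.ofReal r • μ).IsHaarMeasure :=
  Measure.IsHaarMeasure.smul _ (by simpa using hr) ENNReal.ofReal_ne_top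

/-- On a second countable locally compact group a Haar measure is regular, hence determined by the
integrals of continuous functions with compact support. -/
lemma HasIwasawaFormula.unique [BorelSpace G] [LocallyCompactSpace G] [SecondCountableTopology G]
    [T2Space G] {c : ℝ} {μ ν : Measure G} [μ.IsHaarMeasure] [ν.IsHaarMeasure]
    (hμ : HasIwasawaFormula k d n c μ) (hν : HasIwasawaFormula k d n c ν) : μ = ν := by
  refine Measure.ext_of_integral_eq_on_compactlySupported fun f => ?_
  have hf : Continuous fun x => (f x : ℂ) := Complex.continuous_ofReal.comp f.continuous
  have hfc : HasCompactSupport fun x => (f x : ℂ) :=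
    f.hasCompactSupport.comp_left (g := fun y : ℝ => (y : ℂ)) Complex.ofReal_zero
  have h := (hμ _ hf hfc).2.trans (hν _ hf hfc).2.symm
  rw [integral_complex_ofReal, integral_complex_ofReal] at h
  exact Complex.ofReal_injective h

/-- A Haar measure with normalising constant `1` can be rescaled to any positive constant. -/
lemma HasIwasawaFormula.haarIwasawa [BorelSpace G] [LocallyCompactSpace G]
    [SecondCountableTopology G] [T2Space G] {μ : Measure G} [μ.IsHaarMeasure]
    (h : HasIwasawaFormula k d n 1 μ) : HaarIwasawa k d n := by
  intro κ hκ
  have hpos : 0 < κ / (4 * Real.pi) := by positivity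
  have hμ := h.smul hpos.le
  rw [mul_one] at hμ
  have := isHaarMeasure_ofReal_smul hpos μ
  refine ⟨_, ⟨this, hμ⟩, ?_⟩
  rintro ν ⟨hν, hνf⟩
  exact hνf.unique hμ

lemma haarIwasawaPlanck : HaarIwasawaPlanck k d n := by
  rintro h _ hh rfl μ hμ hf
  have hpos : 0 < h / (2 * Real.pi) := by positivity
  have hs := hf.smul hpos.le
  have h1 : h / (2 * Real.pi) * (1 / (4 * Real.pi)) = h / (2 * Real.pi) / (4 * Real.pi) := by ring
  have h2 : h / (2 * Real.pi) * (1 / (4 * Real.pi)) = h / (8 * Real.pi ^ 2) := by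
    field_simp
    norm_num
  exact ⟨isHaarMeasure_ofReal_smul hpos μ, h1 ▸ hs, h2 ▸ hs⟩

end Group

instance : LocallyCompactSpace SU11 :=
  cayleyEquiv.symm.toHomeomorph.isClosedEmbedding.locallyCompactSpace

instance : SecondCountableTopology SU11 :=
  cayleyEquiv.symm.toHomeomorph.secondCountableTopology

instance : T2Space SU11 :=
  cayleyEquiv.toHomeomorph.t2Space

theorem proposition2p4 [MeasurableSpace SU11] [BorelSpace SU11]
    [MeasurableSpace SpinHalf] [BorelSpace SpinHalf] :
    (∃ w : SpinHalf ≃ₜ* SU11,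
      (∀ g : SpinHalf,
        (((w g : SU11) : Matrix.SpecialLinearGroup (Fin 2) ℂ) : Matrix (Fin 2) (Fin 2) ℂ) =
          cayleyC * (g : Matrix (Fin 2) (Fin 2) ℝ).map (fun x : ℝ => (x : ℂ)) * cayleyC⁻¹) ∧
      (∀ θ : ℝ, w (SpinHalf.k θ) = SU11.k θ) ∧
      (∀ t : ℝ, w (SpinHalf.d t) = SU11.d t) ∧
      (∀ ξ : ℝ, w (SpinHalf.n ξ) = SU11.n ξ)) ∧
    IsIwasawaDecomposition SU11.k SU11.d SU11.n ∧
    IsIwasawaDecomposition SpinHalf.k SpinHalf.d SpinHalf.n ∧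
    HaarIwasawa SU11.k SU11.d SU11.n ∧
    HaarIwasawa SpinHalf.k SpinHalf.d SpinHalf.n ∧
    HaarIwasawaPlanck SU11.k SU11.d SU11.n ∧
    HaarIwasawaPlanck SpinHalf.k SpinHalf.d SpinHalf.n :=
  ⟨⟨cayleyEquiv, coe_cayleyFun, cayleyEquiv_k, cayleyEquiv_d, cayleyEquiv_n⟩,
    SpinHalf.isIwasawaDecomposition.map cayleyEquiv.toMulEquiv cayleyEquiv_k cayleyEquiv_d
      cayleyEquiv_n,
    SpinHalf.isIwasawaDecomposition,
    (SpinHalf.hasIwasawaFormula_iwasawaMeasure.map cayleyEquiv cayleyEquiv_k cayleyEquiv_d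
      cayleyEquiv_n).haarIwasawa,
    SpinHalf.hasIwasawaFormula_iwasawaMeasure.haarIwasawa,
    haarIwasawaPlanck, haarIwasawaPlanck⟩
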